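/- Let $G=(V,E)$ be a finite connected undirected graph with $n=|V|\ge 1$ vertices (the players), with edge weights $w_{ij}=w_{ji}>0$ for $(i,j)\in E$ ($w_{ij}=0$ if $(i,j)\notin E$), and let $w_{\max}$ be the largest edge weight ($0$ if there are no edges). In an opinion game on $G$, each player $i$ has an internal belief $b_i\in[0,1]$, chooses an opinion $x_i\in\{0,1\}$, and has in the profile $\mathbf x\in\{0,1\}^V$ the utility $$u_i(\mathbf x)=-\Big((x_i-b_i)^2+\sum_{j:(i,j)\in E}w_{ij}(x_i-x_j)^2\Big).$$ The logit dynamics with rationality level $\beta\ge 0$ is the Markov chain on $\{0,1\}^V$ which at every step selects a player $i$ uniformly at random and replaces his opinion by $s\in\{0,1\}$ with probability $$\sigma_i(s\mid\mathbf x_{-i})=\frac{e^{\beta u_i(\mathbf x_{-i},s)}}{\sum_{z\in\{0,1\}}e^{\beta u_i(\mathbf x_{-i},z)}}.$$ Let $P$ be its transition matrix. The weighted cutwidth ${\sf CW}(G)$ is the minimum, over all orderings $v_1,\dots,v_n$ of $V$, of $\max_{1\le k<n}\sum_{i\le k<j}w_{v_iv_j}$ (an empty maximum is $0$). There are a polynomial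 $p\in\mathbb R[X,Y]$ and a constant $C>0$ such that for every such graph, all such weights and beliefs, and every $\beta\ge 0$, the chain has a unique stationary distribution $\pi$, there is a $t\in\mathbb N$ with $\max_{\mathbf x}\|P^t(\mathbf x,\cdot)-\pi\|_{TV}\le \frac14$, and the least such $t$, the mixing time $t_{\mathrm{mix}}$, satisfies $$t_{\mathrm{mix}}\le(1+\beta)\cdot p(n,w_{\max})\cdot e^{\beta\,C\,{\sf CW}(G)}.$$ -/

import Mathlib

universe u

noncomputable section

/-! ### Opinion games -/

/-- A (two-strategy) opinion game on the graph `G`: symmetric real weights `w i j`, positive on the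
edges of `G` and zero off the edges, and an internal belief `b i ∈ [0, 1]` for every player `i`. -/
structure OpinionGame {V : Type u} (G : SimpleGraph V) where
  /-- edge weights -/
  w : V → V → ℝ
  /-- internal beliefs -/
  b : V → ℝ
  w_symm : ∀ i j, w i j = w j i
  w_pos : ∀ i j, G.Adj i j → 0 < w i j
  w_zero : ∀ i j, ¬ G.Adj i j → w i j = 0
  b_mem : ∀ i, b i ∈ Set.Icc (0 : ℝ) 1

/-- Strategy profiles: every player holds opinion `0` or `1`. -/
abbrev Profile (V : Type u) : Type u := V → Fin 2

/-- The opinion of player `i` in the profile `x`, as a real number. -/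
def Profile.val {V : Type u} (x : Profile V) (i : V) : ℝ := ((x i : ℕ) : ℝ)

namespace OpinionGame

variable {V : Type u} [Fintype V] [DecidableEq V] {G : SimpleGraph V}

/-- The utility `u_i(x) = -((x_i - b_i)² + ∑_j w_ij (x_i - x_j)²)`; since `w i j = 0` off the edges,
the sum is over the edges at `i`. -/
def utility (g : OpinionGame G) (i : V) (x : Profile V) : ℝ :=
  -((x.val i - g.b i) ^ 2 + ∑ j, g.w i j * (x.val i - x.val j) ^ 2)

/-- The Boltzmann probability `σ_i(s | x_{-i})` that the selected player `i` chooses `s`. -/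
def updateProb (g : OpinionGame G) (β : ℝ) (i : V) (s : Fin 2) (x : Profile V) : ℝ :=
  Real.exp (β * g.utility i (Function.update x i s)) /
    ∑ z : Fin 2, Real.exp (β * g.utility i (Function.update x i z))

/-- Transition matrix of the logit dynamics: a uniformly random player `i` is selected and updates
to a random strategy drawn from `σ_i(· | x_{-i})`. For `y = x` all players contribute to the sum,
for `y` differing from `x` exactly at `i` only `i` does, and otherwise the sum is zero. -/
def logitMatrix (g : OpinionGame G) (β : ℝ) : Matrix (Profile V) (Profile V) ℝ :=
  fun x y => (1 / (Fintype.card V : ℝ)) *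
    ∑ i, if ∀ j, j ≠ i → y j = x j then g.updateProb β i (y i) x else 0

/-- The largest edge weight (`0` if there are no edges). -/
def wMax (g : OpinionGame G) : ℝ := ⨆ e : V × V, g.w e.1 e.2

/-- The total weight of the edges with one endpoint in `L` and the other one in its complement. -/
def cutWeight (g : OpinionGame G) (L : Finset V) : ℝ := ∑ i ∈ L, ∑ j ∈ Lᶜ, g.w i j

/-- The weighted cutwidth: the minimum over all orderings of the vertices of the largest weight of
a cut between a nonempty proper initial segment and the rest (`0` on a one-vertex graph). -/
def cutwidth (g : OpinionGame G) : ℝ :=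
  ⨅ σ : V ≃ Fin (Fintype.card V), ⨆ i : {i : Fin (Fintype.card V) // 0 < (i : ℕ)},
    g.cutWeight (Finset.univ.filter fun v => σ v < i.1)

end OpinionGame

/-! ### Mixing time of finite Markov chains -/

/-- `π` is a stationary distribution of the transition matrix `P`. -/
structure IsStationaryDist {S : Type u} [Fintype S] (P : Matrix S S ℝ) (π : S → ℝ) : Prop where
  nonneg : ∀ x, 0 ≤ π x
  sum_eq_one : ∑ x, π x = 1
  stationary : Matrix.vecMul π P = π

/-- Total variation distance of two distributions on a finite set. -/
def tvDist {S : Type u} [Fintype S] (μ ν : S → ℝ) : ℝ := (1 / 2) * ∑ x, |μ x - ν x|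

/-- `d(t) = max_x ‖P^t(x, ·) - π‖_TV`. -/
def distToStationary {S : Type u} [Fintype S] [DecidableEq S]
    (P : Matrix S S ℝ) (π : S → ℝ) (t : ℕ) : ℝ :=
  ⨆ x : S, tvDist ((P ^ t) x) π

/-- The set of times `t` with `d(t) ≤ ε`. -/
def mixedTimes {S : Type u} [Fintype S] [DecidableEq S]
    (P : Matrix S S ℝ) (π : S → ℝ) (ε : ℝ) : Set ℕ :=
  {t | distToStationary P π t ≤ ε}

/-- The mixing time `t_mix(ε)`: the least `t` with `d(t) ≤ ε` (meaningful if there is one). -/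
def mixingTime {S : Type u} [Fintype S] [DecidableEq S]
    (P : Matrix S S ℝ) (π : S → ℝ) (ε : ℝ) : ℕ :=
  sInf (mixedTimes P π ε)

end

/-! The game has an exact potential Φ (`potential`), so the logit dynamics is the heat bath for the
Gibbs measure π ∝ exp(-βΦ). Updating player i is conditional expectation given the other opinions,
an orthogonal projection in L²(π). The transition operator P is an average of such projections,
hence self-adjoint with ⟨Pf,Pf⟩ ≤ ⟨f,Pf⟩, and its Dirichlet form is a sum over single flips. No
laziness is needed: a Poincaré inequality with constant ρ alone makes the χ²-distance to π shrink by
1 - 1/ρ per step, and it also gives uniqueness.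

The Poincaré inequality comes from canonical paths: turn x into y one vertex at a time along an
ordering of minimal cutwidth. After the initial segment L has been treated, (x, y) is replaced by
the pair `mix L x y`, `mix L y x`. This exchange is an involution on pairs and raises the total
potential by at most 2 cut(L) (`potential_mix_add_le`), so π(x)π(y) grows by at most exp(2β CW) when
compared with the exchanged pair. Changing variables by the involution replaces the usual congestion
count (`sum_path_step_le`). This yields ρ = 2n² exp(2β CW), and log(1/π) is at most linear in β and
polynomial in n and the maximal weight. -/

noncomputable section

/-! ### `L²` contraction and mixing of reversible chains -/

open Finset Matrix

section ReversibleChain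

variable {S : Type u} [Fintype S]

/-- The centred density of `μ` with respect to `π`. -/
def centredDensity (π μ : S → ℝ) (y : S) : ℝ := μ y / π y - 1

theorem isStationaryDist_of_reversible {P : Matrix S S ℝ} {π : S → ℝ} (hpos : ∀ x, 0 < π x)
    (hsum : ∑ x, π x = 1) (hrow : ∀ x, ∑ y, P x y = 1)
    (hrev : ∀ x y, π x * P x y = π y * P y x) : IsStationaryDist P π where
  nonneg x := (hpos x).le
  sum_eq_one := hsum
  stationary := by
    ext y
    simp only [vecMul, dotProduct]
    simp_rw [fun x => hrev x y]
    rw [← mul_sum, hrow, mul_one]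

theorem sum_mul_centredDensity {π μ : S → ℝ} (hpos : ∀ x, 0 < π x) (hsum : ∑ x, π x = 1) :
    ∑ y, π y * centredDensity π μ y = ∑ y, μ y - 1 := by
  rw [← hsum, ← sum_sub_distrib]
  refine sum_congr rfl fun y _ => ?_
  have := (hpos y).ne'
  rw [centredDensity]
  field_simp

/-- By reversibility P is self-adjoint in L²(π), so evolving a distribution amounts to applying P to
its density. -/
theorem mulVec_centredDensity {P : Matrix S S ℝ} {π : S → ℝ} (hpos : ∀ x, 0 < π x)
    (hrow : ∀ x, ∑ y, P x y = 1) (hrev : ∀ x y, π x * P x y = π y * P y x) (μ : S → ℝ) :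
    P *ᵥ centredDensity π μ = centredDensity π (μ ᵥ* P) := by
  ext y
  simp only [mulVec, dotProduct, vecMul, centredDensity, mul_sub, sum_sub_distrib, mul_one, hrow]
  rw [sum_div]
  congr 1
  refine sum_congr rfl fun z _ => ?_
  have h1 := (hpos y).ne'
  have h2 := (hpos z).ne'
  have := hrev y z
  field_simp
  linear_combination μ z * this

theorem sum_vecMul_of_row_sum {P : Matrix S S ℝ} (hrow : ∀ x, ∑ y, P x y = 1) (μ : S → ℝ) :
    ∑ y, (μ ᵥ* P) y = ∑ y, μ y := by
  simp only [vecMul, dotProduct]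
  rw [sum_comm]
  simp_rw [← mul_sum, hrow, mul_one]

/-- The centred density of a stationary distribution is fixed by P, so its Dirichlet form vanishes
and the Poincaré inequality kills its variance. -/
theorem eq_of_isStationaryDist_of_poincare {P : Matrix S S ℝ} {π : S → ℝ} {ρ : ℝ}
    (hpos : ∀ x, 0 < π x) (hsum : ∑ x, π x = 1) (hrow : ∀ x, ∑ y, P x y = 1)
    (hrev : ∀ x y, π x * P x y = π y * P y x)
    (hpoin : ∀ f : S → ℝ, ∑ x, π x * f x = 0 →
      ∑ x, π x * f x ^ 2 ≤ ρ * (∑ x, π x * f x ^ 2 - ∑ x, π x * (f x * (P *ᵥ f) x)))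
    {π' : S → ℝ} (h : IsStationaryDist P π') : π' = π := by
  have h0 := hpoin (centredDensity π π')
    (by rw [sum_mul_centredDensity hpos hsum, h.sum_eq_one, sub_self])
  rw [mulVec_centredDensity hpos hrow hrev, h.stationary] at h0
  simp only [← sq, sub_self, mul_zero] at h0
  have hnn : ∀ x ∈ univ, 0 ≤ π x * centredDensity π π' x ^ 2 :=
    fun x _ => mul_nonneg (hpos x).le (sq_nonneg _)
  have h1 := (sum_eq_zero_iff_of_nonneg hnn).1 (le_antisymm h0 (sum_nonneg hnn))
  ext x
  have h2 := h1 x (mem_univ x)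
  rw [mul_eq_zero, or_iff_right (hpos x).ne', sq_eq_zero_iff, centredDensity, sub_eq_zero,
    div_eq_one_iff_eq (hpos x).ne'] at h2
  exact h2

theorem sq_two_mul_tvDist_le {π : S → ℝ} (hpos : ∀ x, 0 < π x) (hsum : ∑ x, π x = 1)
    (μ : S → ℝ) : (2 * tvDist μ π) ^ 2 ≤ ∑ y, π y * centredDensity π μ y ^ 2 := by
  have h1 : 2 * tvDist μ π = ∑ y, π y * |centredDensity π μ y| := by
    rw [tvDist, ← mul_assoc, mul_one_div_cancel two_ne_zero, one_mul]
    refine sum_congr rfl fun y _ => ?_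
    rw [← abs_of_pos (hpos y), ← abs_mul, abs_of_pos (hpos y), centredDensity, mul_sub,
      mul_div_cancel₀ _ (hpos y).ne', mul_one]
  rw [h1]
  calc _ ≤ ∑ y, π y * |centredDensity π μ y| ^ 2 :=
        (Even.convexOn_pow even_two).map_sum_le
          (fun y _ => (hpos y).le) hsum fun _ _ => Set.mem_univ _
    _ = _ := by simp_rw [sq_abs]

variable [DecidableEq S]

theorem sum_mul_centredDensity_pow_le {P : Matrix S S ℝ} {π : S → ℝ} {ρ : ℝ} (hρ : 0 < ρ)
    (hpos : ∀ x, 0 < π x) (hsum : ∑ x, π x = 1) (hrow : ∀ x, ∑ y, P x y = 1)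
    (hrev : ∀ x y, π x * P x y = π y * P y x)
    (hcontr : ∀ f : S → ℝ, ∑ x, π x * (P *ᵥ f) x ^ 2 ≤ ∑ x, π x * (f x * (P *ᵥ f) x))
    (hpoin : ∀ f : S → ℝ, ∑ x, π x * f x = 0 →
      ∑ x, π x * f x ^ 2 ≤ ρ * (∑ x, π x * f x ^ 2 - ∑ x, π x * (f x * (P *ᵥ f) x)))
    (x : S) (t : ℕ) : ∑ y, (P ^ t) x y = 1 ∧
      ∑ y, π y * centredDensity π ((P ^ t) x) y ^ 2 ≤ Real.exp (-(1 / ρ)) ^ t * (1 / π x) := by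
  induction t with
  | zero =>
    have h1 : ∑ y, (P ^ 0) x y = 1 := by simp [Matrix.one_apply]
    refine ⟨h1, ?_⟩
    -- Expanding the square for the point mass at x; the total is 1 / π x - 1.
    have h2 : ∀ y, π y * centredDensity π ((P ^ 0) x) y ^ 2 =
        (if x = y then 1 / π x else 0) - (2 * (P ^ 0) x y - π y) := by
      intro y
      have := (hpos y).ne'
      rw [centredDensity, pow_zero, Matrix.one_apply]
      split_ifs with h
      · subst h; field_simp; ring
      · simp
    simp_rw [h2, sum_sub_distrib, ← mul_sum, h1, hsum]
    rw [sum_ite_eq, if_pos (mem_univ _)]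
    norm_num
  | succ t ih =>
    have h0 : (P ^ (t + 1)) x = (P ^ t) x ᵥ* P := by rw [pow_succ]; rfl
    rw [h0]
    refine ⟨by rw [sum_vecMul_of_row_sum hrow, ih.1], ?_⟩
    rw [← mulVec_centredDensity hpos hrow hrev]
    have h1 := hcontr (centredDensity π ((P ^ t) x))
    have h2 := hpoin (centredDensity π ((P ^ t) x))
      (by rw [sum_mul_centredDensity hpos hsum, ih.1, sub_self])
    set N := ∑ y, π y * centredDensity π ((P ^ t) x) y ^ 2 with hN
    have hN0 : 0 ≤ N := sum_nonneg fun y _ => mul_nonneg (hpos y).le (sq_nonneg _)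
    have h3 : 1 / ρ * N ≤ N - ∑ y, π y * (centredDensity π ((P ^ t) x) y *
        (P *ᵥ centredDensity π ((P ^ t) x)) y) := by
      rw [one_div_mul_eq_div, div_le_iff₀' hρ]; exact h2
    -- The exponential stays positive even if 1 - 1/ρ is negative, so the induction hypothesis can
    -- be multiplied by it.
    have h4 : 1 - 1 / ρ ≤ Real.exp (-(1 / ρ)) := by
      have := Real.add_one_le_exp (-(1 / ρ)); linarith
    calc _ ≤ _ := h1
      _ ≤ (1 - 1 / ρ) * N := by linarith
      _ ≤ Real.exp (-(1 / ρ)) * N := mul_le_mul_of_nonneg_right h4 hN0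
      _ ≤ Real.exp (-(1 / ρ)) * (Real.exp (-(1 / ρ)) ^ t * (1 / π x)) :=
        mul_le_mul_of_nonneg_left ih.2 (Real.exp_pos _).le
      _ = _ := by rw [pow_succ]; ring

theorem mem_mixedTimes_of_poincare [Nonempty S] {P : Matrix S S ℝ} {π : S → ℝ} {ρ : ℝ}
    (hρ : 0 < ρ)
    (hpos : ∀ x, 0 < π x) (hsum : ∑ x, π x = 1) (hrow : ∀ x, ∑ y, P x y = 1)
    (hrev : ∀ x y, π x * P x y = π y * P y x)
    (hcontr : ∀ f : S → ℝ, ∑ x, π x * (P *ᵥ f) x ^ 2 ≤ ∑ x, π x * (f x * (P *ᵥ f) x))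
    (hpoin : ∀ f : S → ℝ, ∑ x, π x * f x = 0 →
      ∑ x, π x * f x ^ 2 ≤ ρ * (∑ x, π x * f x ^ 2 - ∑ x, π x * (f x * (P *ᵥ f) x)))
    {c : ℝ} (hc : ∀ x, 1 / π x ≤ Real.exp c) {t : ℕ} (ht : ρ * (2 + c) ≤ t) :
    t ∈ mixedTimes P π (1 / 4) := by
  change (⨆ x : S, tvDist ((P ^ t) x) π) ≤ 1 / 4
  refine ciSup_le fun x => ?_
  have h1 := (sum_mul_centredDensity_pow_le hρ hpos hsum hrow hrev hcontr hpoin x t).2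
  have h2 := sq_two_mul_tvDist_le hpos hsum ((P ^ t) x)
  -- In ρ(2 + c), the c absorbs 1 / π x and the 2 leaves exp(-2) ≤ 1/4, which bounds (2 TV)².
  have h3 : Real.exp (-(1 / ρ)) ^ t * (1 / π x) ≤ Real.exp (-2) := by
    calc _ ≤ Real.exp (-(1 / ρ)) ^ t * Real.exp c := by
          gcongr; exact hc x
      _ = Real.exp (t * -(1 / ρ) + c) := by rw [Real.exp_add, Real.exp_nat_mul]
      _ ≤ _ := by
        refine Real.exp_le_exp.2 ?_
        have : 2 + c ≤ t / ρ := by rw [le_div_iff₀' hρ]; exact ht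
        have h : (t : ℝ) * -(1 / ρ) = -(t / ρ) := by ring
        linarith
  have h4 : Real.exp (-2) ≤ 1 / 4 := by
    rw [Real.exp_neg, ← one_div]
    refine one_div_le_one_div_of_le (by norm_num) ?_
    have := Real.add_one_le_exp (1 : ℝ)
    have h : Real.exp 2 = Real.exp 1 * Real.exp 1 := by rw [← Real.exp_add]; norm_num
    nlinarith
  nlinarith

end ReversibleChain
end

noncomputable section
open Finset Matrix

/-! ### Averaging over the orbits of an involution -/

section Involution

variable {S : Type u}

/-- The conditional expectation of `f` under `π` given the orbit of the involution `F`. -/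
def orbitAvg (π : S → ℝ) (F : S → S) (f : S → ℝ) (x : S) : ℝ :=
  (π x * f x + π (F x) * f (F x)) / (π x + π (F x))

/-- The harmonic weight of the pair `x`, `F x`. -/
def conductance (π : S → ℝ) (F : S → S) (x : S) : ℝ := π x * π (F x) / (π x + π (F x))

theorem conductance_nonneg {π : S → ℝ} (hpos : ∀ x, 0 < π x) (F : S → S) (x : S) :
    0 ≤ conductance π F x :=
  div_nonneg (mul_pos (hpos _) (hpos _)).le (add_pos (hpos _) (hpos _)).le

variable [Fintype S]

theorem sum_comp_involutive {F : S → S} (hF : Function.Involutive F) (h : S → ℝ) :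
    ∑ x, h (F x) = ∑ x, h x :=
  Equiv.sum_comp (hF.toPerm F) h

/-- Conditional expectation is an orthogonal projection. Adding the sum to its reindexing by F makes
the identity hold term by term, fixed points included. -/
theorem sum_mul_orbitAvg_sq {π : S → ℝ} (hpos : ∀ x, 0 < π x) {F : S → S}
    (hF : Function.Involutive F) (f : S → ℝ) :
    ∑ x, π x * orbitAvg π F f x ^ 2 = ∑ x, π x * (f x * orbitAvg π F f x) := by
  have key : ∑ x, (π x * orbitAvg π F f x ^ 2 - π x * (f x * orbitAvg π F f x)) +
      ∑ x, (π (F x) * orbitAvg π F f (F x) ^ 2 -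
        π (F x) * (f (F x) * orbitAvg π F f (F x))) = 0 := by
    rw [← sum_add_distrib]
    refine sum_eq_zero fun x _ => ?_
    have h := (add_pos (hpos x) (hpos (F x))).ne'
    have h' := (add_pos (hpos (F x)) (hpos x)).ne'
    simp only [orbitAvg, hF x]
    field_simp
    ring
  rw [sum_comp_involutive hF fun x =>
    π x * orbitAvg π F f x ^ 2 - π x * (f x * orbitAvg π F f x), sum_sub_distrib] at key
  linarith

theorem sum_mul_sq_sub_sum_mul_orbitAvg {π : S → ℝ} (hpos : ∀ x, 0 < π x) {F : S → S}
    (hF : Function.Involutive F) (f : S → ℝ) :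
    ∑ x, π x * f x ^ 2 - ∑ x, π x * (f x * orbitAvg π F f x) =
      1 / 2 * ∑ x, conductance π F x * (f x - f (F x)) ^ 2 := by
  have key : ∑ x, (π x * f x ^ 2 - π x * (f x * orbitAvg π F f x)) +
      ∑ x, (π (F x) * f (F x) ^ 2 - π (F x) * (f (F x) * orbitAvg π F f (F x))) =
      ∑ x, conductance π F x * (f x - f (F x)) ^ 2 := by
    rw [← sum_add_distrib]
    refine sum_congr rfl fun x _ => ?_
    have h := (add_pos (hpos x) (hpos (F x))).ne'
    have h' := (add_pos (hpos (F x)) (hpos x)).ne'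
    simp only [orbitAvg, conductance, hF x]
    field_simp
    ring
  rw [sum_comp_involutive hF fun x => π x * f x ^ 2 - π x * (f x * orbitAvg π F f x),
    sum_sub_distrib] at key
  linarith

variable {ι : Type u} [Fintype ι] [Nonempty ι]

/-- The square of an average is at most the average of the squares, and each term is a projection.
-/
theorem contraction_of_mulVec_eq_orbitAvg {P : Matrix S S ℝ} {π : S → ℝ} (hpos : ∀ x, 0 < π x)
    {F : ι → S → S} (hF : ∀ i, Function.Involutive (F i)) (f : S → ℝ)
    (hP : ∀ x, (P *ᵥ f) x = 1 / (Fintype.card ι : ℝ) * ∑ i, orbitAvg π (F i) f x) :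
    ∑ x, π x * (P *ᵥ f) x ^ 2 ≤ ∑ x, π x * (f x * (P *ᵥ f) x) := by
  have hn : (0 : ℝ) < Fintype.card ι := by exact_mod_cast Fintype.card_pos
  calc ∑ x, π x * (P *ᵥ f) x ^ 2
      ≤ ∑ x, π x * (1 / (Fintype.card ι : ℝ) * ∑ i, orbitAvg π (F i) f x ^ 2) := by
        refine sum_le_sum fun x _ => mul_le_mul_of_nonneg_left ?_ (hpos x).le
        rw [hP, mul_pow]
        have := sq_sum_le_card_mul_sum_sq (s := univ) (f := fun i => orbitAvg π (F i) f x)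
        rw [card_univ] at this
        calc _ ≤ (1 / (Fintype.card ι : ℝ)) ^ 2 *
              (Fintype.card ι * ∑ i, orbitAvg π (F i) f x ^ 2) := by gcongr
          _ = _ := by field_simp
    _ = 1 / (Fintype.card ι : ℝ) * ∑ i, ∑ x, π x * orbitAvg π (F i) f x ^ 2 := by
        rw [sum_comm, mul_sum]
        refine sum_congr rfl fun x _ => ?_
        rw [mul_left_comm, mul_sum]
    _ = 1 / (Fintype.card ι : ℝ) * ∑ i, ∑ x, π x * (f x * orbitAvg π (F i) f x) := by
        simp_rw [sum_mul_orbitAvg_sq hpos (hF _)]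
    _ = _ := by
        rw [sum_comm, mul_sum]
        refine sum_congr rfl fun x _ => ?_
        rw [hP, ← mul_sum, ← mul_sum]
        ring

theorem dirichlet_of_mulVec_eq_orbitAvg {P : Matrix S S ℝ} {π : S → ℝ} (hpos : ∀ x, 0 < π x)
    {F : ι → S → S} (hF : ∀ i, Function.Involutive (F i)) (f : S → ℝ)
    (hP : ∀ x, (P *ᵥ f) x = 1 / (Fintype.card ι : ℝ) * ∑ i, orbitAvg π (F i) f x) :
    ∑ x, π x * f x ^ 2 - ∑ x, π x * (f x * (P *ᵥ f) x) =
      1 / (2 * (Fintype.card ι : ℝ)) *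
        ∑ i, ∑ x, conductance π (F i) x * (f x - f (F i x)) ^ 2 := by
  have hn : (Fintype.card ι : ℝ) ≠ 0 := by exact_mod_cast Fintype.card_ne_zero
  have h1 : ∑ x, π x * (f x * (P *ᵥ f) x) =
      1 / (Fintype.card ι : ℝ) * ∑ i, ∑ x, π x * (f x * orbitAvg π (F i) f x) := by
    rw [sum_comm, mul_sum]
    refine sum_congr rfl fun x _ => ?_
    rw [hP, ← mul_sum, ← mul_sum]
    ring
  have h2 : ∀ i, ∑ x, π x * (f x * orbitAvg π (F i) f x) = ∑ x, π x * f x ^ 2 -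
      1 / 2 * ∑ x, conductance π (F i) x * (f x - f (F i x)) ^ 2 := fun i => by
    rw [← sum_mul_sq_sub_sum_mul_orbitAvg hpos (hF i) f]; ring
  rw [h1]
  simp_rw [h2]
  rw [sum_sub_distrib, sum_const, card_univ, nsmul_eq_mul, ← mul_sum]
  field_simp
  ring

end Involution

/-! ### Flipping and mixing profiles -/

namespace Profile

variable {V : Type u}

theorem val_nonneg (x : Profile V) (v : V) : 0 ≤ x.val v := Nat.cast_nonneg _

theorem val_le_one (x : Profile V) (v : V) : x.val v ≤ 1 := by
  have := (x v).is_lt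
  simp only [Profile.val, Nat.cast_le_one]
  omega

variable [DecidableEq V]

/-- The profile in which player `v` has changed his opinion. -/
def flipAt (v : V) (x : Profile V) : Profile V := Function.update x v (x v + 1)

theorem flipAt_involutive (v : V) : Function.Involutive (flipAt v) := by
  intro x
  have h : ∀ a : Fin 2, a + 1 + 1 = a := by decide
  simp [flipAt, h]

theorem fin_two_eq_add_one {a b : Fin 2} (h : a ≠ b) : a = b + 1 := by
  revert a b; decide

theorem sum_update {M : Type*} [AddCommMonoid M] (h : Profile V → M) (v : V) (x : Profile V) :
    ∑ s, h (Function.update x v s) = h x + h (flipAt v x) := by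
  have h2 : ∀ (k : Fin 2 → M) (a : Fin 2), ∑ s, k s = k a + k (a + 1) := by
    intro k a
    fin_cases a
    · simp [Fin.sum_univ_two]
    · simp [Fin.sum_univ_two, add_comm]
  rw [h2 _ (x v), Function.update_eq_self, flipAt]

/-- The profile that agrees with `y` on `L` and with `x` off `L`. -/
def mix (L : Finset V) (x y : Profile V) : Profile V := fun v => if v ∈ L then y v else x v

theorem mix_mix (L : Finset V) (x y : Profile V) : mix L (mix L x y) (mix L y x) = x := by
  ext v
  by_cases h : v ∈ L <;> simp [mix, h]

theorem mix_insert (L : Finset V) (v : V) (x y : Profile V) :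
    mix (insert v L) x y = Function.update (mix L x y) v (y v) := by
  ext u
  by_cases h : u = v
  · subst h; simp [mix]
  · simp [mix, h]

theorem mix_insert_of_eq (L : Finset V) {v : V} {x y : Profile V} (h : y v = x v) :
    mix (insert v L) x y = mix L x y := by
  rw [mix_insert, Function.update_eq_self_iff]
  simp [mix, h]

theorem mix_insert_of_ne {L : Finset V} {v : V} (hv : v ∉ L) {x y : Profile V}
    (h : y v ≠ x v) : mix (insert v L) x y = flipAt v (mix L x y) := by
  rw [mix_insert, flipAt, fin_two_eq_add_one h]
  simp [mix, hv]

theorem mix_swap_involutive (L : Finset V) : Function.Involutive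
    fun p : Profile V × Profile V => (mix L p.1 p.2, mix L p.2 p.1) := by
  rintro ⟨x, y⟩
  simp [mix_mix]

end Profile

/-! ### The Poincaré inequality along an ordering -/

section CanonicalPaths

open Profile

variable {V : Type u} [Fintype V]

/-- The first `k` vertices in the ordering `σ`. -/
def initSeg (σ : V ≃ Fin (Fintype.card V)) (k : ℕ) : Finset V := univ.filter fun v => (σ v : ℕ) < k

theorem notMem_initSeg (σ : V ≃ Fin (Fintype.card V)) (v : V) : v ∉ initSeg σ (σ v) := by
  simp [initSeg]

theorem initSeg_zero (σ : V ≃ Fin (Fintype.card V)) : initSeg σ 0 = ∅ := by simp [initSeg]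

theorem initSeg_card (σ : V ≃ Fin (Fintype.card V)) : initSeg σ (Fintype.card V) = univ := by
  simp [initSeg]

variable [DecidableEq V]

theorem initSeg_succ (σ : V ≃ Fin (Fintype.card V)) (v : V) :
    initSeg σ (σ v + 1) = insert v (initSeg σ (σ v)) := by
  ext u
  simp only [initSeg, mem_filter, mem_univ, true_and, mem_insert, Nat.lt_succ_iff_lt_or_eq,
    ← Fin.ext_iff, σ.injective.eq_iff]
  tauto

/-- Telescoping along the path from x to y, then Cauchy–Schwarz over its n steps. -/
theorem sq_sub_le_card_mul_sum_path (σ : V ≃ Fin (Fintype.card V)) (f : Profile V → ℝ)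
    (x y : Profile V) : (f x - f y) ^ 2 ≤ Fintype.card V *
      ∑ v, (f (mix (initSeg σ (σ v)) x y) - f (mix (initSeg σ (σ v + 1)) x y)) ^ 2 := by
  have h1 : f x - f y =
      ∑ v, (f (mix (initSeg σ (σ v)) x y) - f (mix (initSeg σ (σ v + 1)) x y)) := by
    rw [Equiv.sum_comp σ fun k : Fin (Fintype.card V) =>
      f (mix (initSeg σ k) x y) - f (mix (initSeg σ (k + 1)) x y),
      Fin.sum_univ_eq_sum_range fun k => f (mix (initSeg σ k) x y) - f (mix (initSeg σ (k + 1)) x y),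
      sum_range_sub', initSeg_zero, initSeg_card]
    have h0 : mix ∅ x y = x := by ext v; simp [mix]
    have hu : mix univ x y = y := by ext v; simp [mix]
    rw [h0, hu]
  rw [h1]
  exact sq_sum_le_card_mul_sum_sq

/-- The contribution of one path step to the variance. Once bounded in terms of the exchanged pair,
it sums over all pairs by the involution, and the second coordinate integrates out. -/
theorem sum_path_step_le {π : Profile V → ℝ} (hpos : ∀ x, 0 < π x) (hsum : ∑ x, π x = 1) {K : ℝ}
    (hK : 0 < K) {L : Finset V} {v : V} (hv : v ∉ L)
    (h1 : ∀ x y, π x * π y ≤ K * (π (mix L x y) * π (mix L y x)))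
    (h2 : ∀ x y, π x * π y ≤ K * (π (mix (insert v L) x y) * π (mix (insert v L) y x)))
    (f : Profile V → ℝ) :
    ∑ x, ∑ y, π x * π y * (f (mix L x y) - f (mix (insert v L) x y)) ^ 2 ≤
      2 * K * ∑ x, conductance π (flipAt v) x * (f x - f (flipAt v x)) ^ 2 := by
  set D : Profile V → ℝ := fun z => conductance π (flipAt v) z * (f z - f (flipAt v z)) ^ 2 with hD
  have hD0 : ∀ z, 0 ≤ D z := fun z =>
    mul_nonneg (conductance_nonneg hpos _ z) (sq_nonneg _)
  have step : ∀ x y, π x * π y * (f (mix L x y) - f (mix (insert v L) x y)) ^ 2 ≤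
      K * (D (mix L x y) * (π (mix L y x) + π (flipAt v (mix L y x)))) := by
    intro x y
    by_cases h : y v = x v
    · rw [mix_insert_of_eq L h, sub_self]
      have := mul_nonneg (hD0 (mix L x y)) (add_pos (hpos (mix L y x))
        (hpos (flipAt v (mix L y x)))).le
      have := mul_nonneg hK.le this
      simpa using this
    · have e1 := h1 x y
      have e2 := h2 x y
      rw [mix_insert_of_ne hv h, mix_insert_of_ne hv (Ne.symm h)] at e2
      rw [mix_insert_of_ne hv h]
      set z := mix L x y
      set z' := mix L y x
      have ha := hpos z
      have hc := hpos (flipAt v z)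
      -- Multiply `e1` by π (flipAt v z) and `e2` by π z, and add: both ends of the flip are needed
      -- to produce the harmonic weight.
      have : π x * π y ≤ K * (conductance π (flipAt v) z * (π z' + π (flipAt v z'))) := by
        rw [conductance, div_mul_eq_mul_div, ← mul_div_assoc, le_div_iff₀ (add_pos ha hc)]
        nlinarith
      calc _ ≤ K * (conductance π (flipAt v) z * (π z' + π (flipAt v z'))) *
            (f z - f (flipAt v z)) ^ 2 := mul_le_mul_of_nonneg_right this (sq_nonneg _)
        _ = _ := by simp only [hD]; ring
  calc _ ≤ ∑ x, ∑ y, K * (D (mix L x y) * (π (mix L y x) + π (flipAt v (mix L y x)))) :=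
        sum_le_sum fun x _ => sum_le_sum fun y _ => step x y
    _ = ∑ p : Profile V × Profile V,
          K * (D (mix L p.1 p.2) * (π (mix L p.2 p.1) + π (flipAt v (mix L p.2 p.1)))) := by
        rw [Fintype.sum_prod_type]
    _ = ∑ p : Profile V × Profile V, K * (D p.1 * (π p.2 + π (flipAt v p.2))) :=
        sum_comp_involutive (mix_swap_involutive L)
          fun p => K * (D p.1 * (π p.2 + π (flipAt v p.2)))
    _ = K * ((∑ z, D z) * (∑ z, π z + ∑ z, π (flipAt v z))) := by
        rw [Fintype.sum_prod_type, ← sum_add_distrib, sum_mul_sum, mul_sum]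
        simp_rw [mul_sum]
    _ = _ := by rw [sum_comp_involutive (flipAt_involutive v) π, hsum]; ring

theorem poincare_of_ordering {π : Profile V → ℝ} (hpos : ∀ x, 0 < π x) (hsum : ∑ x, π x = 1)
    {K : ℝ} (hK : 0 < K) (σ : V ≃ Fin (Fintype.card V))
    (h : ∀ k ≤ Fintype.card V, ∀ x y,
      π x * π y ≤ K * (π (mix (initSeg σ k) x y) * π (mix (initSeg σ k) y x)))
    {f : Profile V → ℝ} (hf : ∑ x, π x * f x = 0) :
    ∑ x, π x * f x ^ 2 ≤
      Fintype.card V * K * ∑ v, ∑ x, conductance π (flipAt v) x * (f x - f (flipAt v x)) ^ 2 := by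
  -- The variance as half the mean square difference of two independent samples.
  have h1 : ∑ x, ∑ y, π x * π y * (f x - f y) ^ 2 = 2 * ∑ x, π x * f x ^ 2 := by
    have : ∀ x y, π x * π y * (f x - f y) ^ 2 =
        π x * f x ^ 2 * π y - 2 * (π x * f x * (π y * f y)) + π x * (π y * f y ^ 2) := by
      intros; ring
    simp_rw [this, sum_add_distrib, sum_sub_distrib, ← mul_sum, ← sum_mul, hf, hsum]
    ring
  have h2 : ∑ x, ∑ y, π x * π y * (f x - f y) ^ 2 ≤ Fintype.card V * ∑ v, ∑ x, ∑ y, π x * π y *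
      (f (mix (initSeg σ (σ v)) x y) - f (mix (insert v (initSeg σ (σ v))) x y)) ^ 2 := by
    calc _ ≤ ∑ x, ∑ y, π x * π y * (Fintype.card V * ∑ v,
          (f (mix (initSeg σ (σ v)) x y) - f (mix (insert v (initSeg σ (σ v))) x y)) ^ 2) := by
          refine sum_le_sum fun x _ => sum_le_sum fun y _ =>
            mul_le_mul_of_nonneg_left ?_ (mul_pos (hpos x) (hpos y)).le
          simp_rw [← initSeg_succ]
          exact sq_sub_le_card_mul_sum_path σ f x y
      _ = _ := by
          simp_rw [mul_sum]
          symm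
          rw [sum_comm]
          refine sum_congr rfl fun x _ => ?_
          rw [sum_comm]
          refine sum_congr rfl fun y _ => sum_congr rfl fun v _ => ?_
          ring
  have h3 : ∀ v, _ := fun v => sum_path_step_le hpos hsum hK (notMem_initSeg σ v)
    (h (σ v) (σ v).is_lt.le) (by rw [← initSeg_succ]; exact h _ (σ v).is_lt) f
  have h4 : ∑ x, ∑ y, π x * π y * (f x - f y) ^ 2 ≤ Fintype.card V * ∑ v,
      (2 * K * ∑ x, conductance π (flipAt v) x * (f x - f (flipAt v x)) ^ 2) :=
    h2.trans (mul_le_mul_of_nonneg_left (sum_le_sum fun v _ => h3 v) (Nat.cast_nonneg _))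
  rw [h1, ← mul_sum] at h4
  linarith

end CanonicalPaths
end

noncomputable section
open Finset Matrix

namespace OpinionGame

open Profile

variable {V : Type u} {G : SimpleGraph V}

/-! ### Edge weights -/

theorem w_nonneg (g : OpinionGame G) (i j : V) : 0 ≤ g.w i j := by
  by_cases h : G.Adj i j
  · exact (g.w_pos i j h).le
  · exact (g.w_zero i j h).ge

theorem wMax_nonneg (g : OpinionGame G) : 0 ≤ g.wMax :=
  Real.iSup_nonneg fun _ => g.w_nonneg _ _

variable [Fintype V]

theorem w_le_wMax (g : OpinionGame G) (i j : V) : g.w i j ≤ g.wMax :=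
  le_ciSup (f := fun e : V × V => g.w e.1 e.2) (Set.finite_range _).bddAbove (i, j)

/-! ### The potential -/

/-- The exact potential of the opinion game. -/
def potential (g : OpinionGame G) (x : Profile V) : ℝ :=
  ∑ i, (x.val i - g.b i) ^ 2 + 1 / 2 * ∑ i, ∑ j, g.w i j * (x.val i - x.val j) ^ 2

theorem potential_nonneg (g : OpinionGame G) (x : Profile V) : 0 ≤ g.potential x :=
  add_nonneg (sum_nonneg fun _ _ => sq_nonneg _) (mul_nonneg (by norm_num)
    (sum_nonneg fun _ _ => sum_nonneg fun _ _ => mul_nonneg (g.w_nonneg _ _) (sq_nonneg _)))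

theorem potential_le (g : OpinionGame G) (x : Profile V) :
    g.potential x ≤ Fintype.card V + (Fintype.card V : ℝ) ^ 2 * g.wMax := by
  have h1 : ∑ i, (x.val i - g.b i) ^ 2 ≤ ∑ _i : V, (1 : ℝ) := sum_le_sum fun i _ => by
    have := x.val_nonneg i
    have := x.val_le_one i
    have := (g.b_mem i).1
    have := (g.b_mem i).2
    rw [sq_le_one_iff_abs_le_one, abs_le]
    constructor <;> linarith
  have h2 : ∑ i, ∑ j, g.w i j * (x.val i - x.val j) ^ 2 ≤ ∑ _i : V, ∑ _j : V, g.wMax :=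
    sum_le_sum fun i _ => sum_le_sum fun j _ => by
      have h : (x.val i - x.val j) ^ 2 ≤ 1 := by
        have := x.val_nonneg i
        have := x.val_le_one i
        have := x.val_nonneg j
        have := x.val_le_one j
        rw [sq_le_one_iff_abs_le_one, abs_le]
        constructor <;> linarith
      calc _ ≤ g.w i j * 1 := mul_le_mul_of_nonneg_left h (g.w_nonneg i j)
        _ ≤ _ := by rw [mul_one]; exact g.w_le_wMax i j
  simp only [sum_const, card_univ, nsmul_eq_mul, mul_one] at h1 h2
  have h3 : 0 ≤ (Fintype.card V : ℝ) * (Fintype.card V * g.wMax) :=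
    mul_nonneg (Nat.cast_nonneg _) (mul_nonneg (Nat.cast_nonneg _) g.wMax_nonneg)
  rw [potential]
  nlinarith

variable [DecidableEq V]

/-! ### The cutwidth -/

theorem cutWeight_nonneg (g : OpinionGame G) (L : Finset V) : 0 ≤ g.cutWeight L :=
  sum_nonneg fun _ _ => sum_nonneg fun _ _ => g.w_nonneg _ _

theorem cutwidth_nonneg (g : OpinionGame G) : 0 ≤ g.cutwidth :=
  Real.iInf_nonneg fun _ => Real.iSup_nonneg fun _ => g.cutWeight_nonneg _

theorem exists_ordering_cutWeight_le_cutwidth (g : OpinionGame G) :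
    ∃ σ : V ≃ Fin (Fintype.card V), ∀ k ≤ Fintype.card V,
      g.cutWeight (initSeg σ k) ≤ g.cutwidth := by
  have : Nonempty (V ≃ Fin (Fintype.card V)) := ⟨Fintype.equivFin V⟩
  obtain ⟨σ, hσ⟩ := exists_eq_ciInf_of_finite (f := fun σ : V ≃ Fin (Fintype.card V) =>
    ⨆ i : {i : Fin (Fintype.card V) // 0 < (i : ℕ)},
      g.cutWeight (Finset.univ.filter fun v => σ v < i.1))
  refine ⟨σ, fun k hk => ?_⟩
  -- The supremum in `cutwidth` omits k = 0 and k = n, where the cut is empty.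
  rcases Nat.eq_zero_or_pos k with rfl | h0
  · rw [initSeg_zero]
    simpa [cutWeight] using g.cutwidth_nonneg
  rcases hk.eq_or_lt with rfl | hlt
  · rw [initSeg_card]
    simpa [cutWeight] using g.cutwidth_nonneg
  · rw [cutwidth, ← hσ]
    exact le_ciSup (f := fun i : {i : Fin (Fintype.card V) // 0 < (i : ℕ)} =>
      g.cutWeight (Finset.univ.filter fun v => σ v < i.1)) (Set.finite_range _).bddAbove
      ⟨⟨k, hlt⟩, h0⟩

theorem cutWeight_eq_sum_ite (g : OpinionGame G) (L : Finset V) :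
    g.cutWeight L = ∑ i, ∑ j, if i ∈ L ∧ j ∉ L then g.w i j else 0 := by
  simp only [cutWeight, ite_and, ← mem_compl]
  rw [← sum_filter_add_sum_filter_not univ (· ∈ L)]
  simp [sum_ite, filter_notMem_eq_sdiff, compl_eq_univ_sdiff]

/-! ### Exactness and the exchange inequality -/

/-- The potential is exact: `potential + utility i` does not depend on the opinion of `i`. -/
theorem potential_add_utility_update (g : OpinionGame G) (x : Profile V) (i : V) (s : Fin 2) :
    g.potential (Function.update x i s) + g.utility i (Function.update x i s) =
      ∑ j ∈ univ.erase i, (x.val j - g.b j) ^ 2 +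
        1 / 2 * ∑ j ∈ univ.erase i, ∑ k ∈ univ.erase i, g.w j k * (x.val j - x.val k) ^ 2 := by
  set y : Profile V := Function.update x i s with hy
  have hval : ∀ j ∈ univ.erase i, y.val j = x.val j := fun j hj => by
    simp [Profile.val, hy, Function.update_of_ne (ne_of_mem_erase hj)]
  have hb : ∑ j, (y.val j - g.b j) ^ 2 =
      (y.val i - g.b i) ^ 2 + ∑ j ∈ univ.erase i, (x.val j - g.b j) ^ 2 := by
    rw [← add_sum_erase _ _ (mem_univ i)]
    exact congrArg _ (sum_congr rfl fun j hj => by rw [hval j hj])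
  have hi : ∑ j, g.w i j * (y.val i - y.val j) ^ 2 =
      ∑ j ∈ univ.erase i, g.w i j * (y.val i - y.val j) ^ 2 := by
    rw [← add_sum_erase _ _ (mem_univ i)]
    simp
  have hw : ∑ j, ∑ k, g.w j k * (y.val j - y.val k) ^ 2 =
      2 * ∑ j ∈ univ.erase i, g.w i j * (y.val i - y.val j) ^ 2 +
        ∑ j ∈ univ.erase i, ∑ k ∈ univ.erase i, g.w j k * (x.val j - x.val k) ^ 2 := by
    rw [← add_sum_erase _ _ (mem_univ i), hi, two_mul, add_assoc]
    refine congrArg _ ?_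
    rw [← sum_add_distrib]
    refine sum_congr rfl fun j hj => ?_
    rw [← add_sum_erase _ _ (mem_univ i), g.w_symm j i]
    refine congrArg₂ _ (by ring) (sum_congr rfl fun k hk => by rw [hval j hj, hval k hk])
  rw [potential, utility, hb, hw, hi]
  ring

/-- Belief terms and edges not crossing the cut are merely swapped between the two profiles; a
crossing edge costs at most its weight in each mixed profile. -/
theorem potential_mix_add_le (g : OpinionGame G) (L : Finset V) (x y : Profile V) :
    g.potential (mix L x y) + g.potential (mix L y x) ≤
      g.potential x + g.potential y + 2 * g.cutWeight L := by
  have hb : ∑ i, ((mix L x y).val i - g.b i) ^ 2 + ∑ i, ((mix L y x).val i - g.b i) ^ 2 =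
      ∑ i, (x.val i - g.b i) ^ 2 + ∑ i, (y.val i - g.b i) ^ 2 := by
    rw [← sum_add_distrib, ← sum_add_distrib]
    refine sum_congr rfl fun i _ => ?_
    by_cases h : i ∈ L <;> simp [Profile.val, mix, h, add_comm]
  have hcut : ∑ i, ∑ j, (if j ∈ L ∧ i ∉ L then g.w i j else 0) = g.cutWeight L := by
    rw [cutWeight_eq_sum_ite, sum_comm]
    refine sum_congr rfl fun i _ => sum_congr rfl fun j _ => ?_
    rw [g.w_symm]
  have hw : ∑ i, ∑ j, g.w i j * ((mix L x y).val i - (mix L x y).val j) ^ 2 +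
      ∑ i, ∑ j, g.w i j * ((mix L y x).val i - (mix L y x).val j) ^ 2 ≤
      ∑ i, ∑ j, g.w i j * (x.val i - x.val j) ^ 2 + ∑ i, ∑ j, g.w i j * (y.val i - y.val j) ^ 2 +
        2 * (g.cutWeight L + g.cutWeight L) := by
    -- One copy of the cut weight per orientation, so that the bound can be checked for each ordered
    -- pair (i, j).
    nth_rw 2 [← hcut]
    rw [cutWeight_eq_sum_ite]
    simp_rw [← sum_add_distrib, mul_sum, ← sum_add_distrib]
    refine sum_le_sum fun i _ => sum_le_sum fun j _ => ?_
    have hw := g.w_nonneg i j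
    have hxi := x.val_nonneg i
    have hxj := x.val_nonneg j
    have hyi := y.val_nonneg i
    have hyj := y.val_nonneg j
    have hxi' := x.val_le_one i
    have hxj' := x.val_le_one j
    have hyi' := y.val_le_one i
    have hyj' := y.val_le_one j
    have h1 : (x.val i - y.val j) ^ 2 ≤ 1 := by
      rw [sq_le_one_iff_abs_le_one, abs_le]; constructor <;> linarith
    have h2 : (y.val i - x.val j) ^ 2 ≤ 1 := by
      rw [sq_le_one_iff_abs_le_one, abs_le]; constructor <;> linarith
    have h3 := mul_le_mul_of_nonneg_left h1 hw
    have h4 := mul_le_mul_of_nonneg_left h2 hw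
    have h5 := mul_nonneg hw (sq_nonneg (x.val i - x.val j))
    have h6 := mul_nonneg hw (sq_nonneg (y.val i - y.val j))
    simp only [Profile.val] at *
    by_cases hi : i ∈ L <;> by_cases hj : j ∈ L <;> simp [mix, hi, hj] <;> linarith
  simp only [potential]
  linarith

/-! ### The Gibbs measure -/

/-- The partition function. -/
def partitionFn (g : OpinionGame G) (β : ℝ) : ℝ := ∑ x, Real.exp (-(β * g.potential x))

/-- The Gibbs measure of the potential. -/
def gibbs (g : OpinionGame G) (β : ℝ) (x : Profile V) : ℝ :=
  Real.exp (-(β * g.potential x)) / g.partitionFn β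

theorem partitionFn_pos (g : OpinionGame G) (β : ℝ) : 0 < g.partitionFn β :=
  sum_pos (fun _ _ => Real.exp_pos _) univ_nonempty

theorem gibbs_pos (g : OpinionGame G) (β : ℝ) (x : Profile V) : 0 < g.gibbs β x :=
  div_pos (Real.exp_pos _) (g.partitionFn_pos β)

theorem sum_gibbs (g : OpinionGame G) (β : ℝ) : ∑ x, g.gibbs β x = 1 := by
  simp only [gibbs]
  rw [← sum_div, ← partitionFn, div_self (g.partitionFn_pos β).ne']

theorem one_div_gibbs_le (g : OpinionGame G) {β : ℝ} (hβ : 0 ≤ β) (x : Profile V) :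
    1 / g.gibbs β x ≤ Real.exp (Fintype.card V +
      β * (Fintype.card V + (Fintype.card V : ℝ) ^ 2 * g.wMax)) := by
  have h1 : g.partitionFn β ≤ Real.exp (Fintype.card V) := by
    calc g.partitionFn β ≤ ∑ _x : Profile V, (1 : ℝ) := sum_le_sum fun y _ => by
          rw [Real.exp_le_one_iff, neg_nonpos]
          exact mul_nonneg hβ (g.potential_nonneg y)
      _ = 2 ^ Fintype.card V := by simp
      _ ≤ Real.exp 1 ^ Fintype.card V := by
          gcongr
          have := Real.add_one_le_exp (1 : ℝ)
          linarith
      _ = _ := by rw [← Real.exp_nat_mul, mul_one]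
  rw [gibbs, one_div_div, Real.exp_neg, div_inv_eq_mul, Real.exp_add]
  gcongr
  exact g.potential_le x

theorem gibbs_mul_gibbs_le (g : OpinionGame G) {β : ℝ} (hβ : 0 ≤ β) (L : Finset V) {c : ℝ}
    (hc : g.cutWeight L ≤ c) (x y : Profile V) : g.gibbs β x * g.gibbs β y ≤
      Real.exp (β * (2 * c)) * (g.gibbs β (mix L x y) * g.gibbs β (mix L y x)) := by
  simp only [gibbs]
  rw [div_mul_div_comm, div_mul_div_comm, ← Real.exp_add, ← Real.exp_add, mul_div_assoc',
    ← Real.exp_add]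
  refine div_le_div_of_nonneg_right (Real.exp_le_exp.2 ?_)
    (mul_pos (g.partitionFn_pos β) (g.partitionFn_pos β)).le
  have h := mul_le_mul_of_nonneg_left
    ((g.potential_mix_add_le L x y).trans (by linarith :
      _ ≤ g.potential x + g.potential y + 2 * c)) hβ
  linarith

/-! ### The logit dynamics as a heat bath for the Gibbs measure -/

theorem updateProb_eq (g : OpinionGame G) (β : ℝ) (i : V) (s : Fin 2) (x : Profile V) :
    g.updateProb β i s x = g.gibbs β (Function.update x i s) /
      (g.gibbs β x + g.gibbs β (flipAt i x)) := by
  rw [← sum_update]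
  -- By exactness, utility and minus potential differ by a constant, which cancels in the Boltzmann
  -- ratio.
  obtain ⟨c, hc⟩ : ∃ c, ∀ z, g.utility i (Function.update x i z) =
      c - g.potential (Function.update x i z) :=
    ⟨_, fun z => eq_sub_of_add_eq' (g.potential_add_utility_update x i z)⟩
  have h : ∀ z, Real.exp (β * g.utility i (Function.update x i z)) =
      Real.exp (β * c) * g.partitionFn β * g.gibbs β (Function.update x i z) := fun z => by
    rw [hc, gibbs, mul_assoc, mul_div_cancel₀ _ (g.partitionFn_pos β).ne', ← Real.exp_add]
    ring_nf
  simp only [updateProb, h]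
  rw [← mul_sum, mul_div_mul_left]
  exact (mul_pos (Real.exp_pos _) (g.partitionFn_pos β)).ne'

theorem logitMatrix_mulVec (g : OpinionGame G) (β : ℝ) (f : Profile V → ℝ) (x : Profile V) :
    (g.logitMatrix β *ᵥ f) x =
      1 / (Fintype.card V : ℝ) * ∑ i, orbitAvg (g.gibbs β) (flipAt i) f x := by
  have hsite : ∀ i, ∑ y : Profile V,
      (if ∀ j, j ≠ i → y j = x j then g.updateProb β i (y i) x else 0) * f y =
        orbitAvg (g.gibbs β) (flipAt i) f x := by
    intro i
    have h1 : ∀ y : Profile V, (∀ j, j ≠ i → y j = x j) ↔ y = Function.update x i (y i) :=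
      fun y => by rw [Function.eq_update_iff]; simp
    have h2 : ∑ y : Profile V,
        (if ∀ j, j ≠ i → y j = x j then g.updateProb β i (y i) x else 0) * f y =
        ∑ s, g.updateProb β i s x * f (Function.update x i s) := by
      simp_rw [ite_mul, zero_mul]
      rw [← sum_filter]
      refine (sum_bij (fun s _ => Function.update x i s) (fun s _ => ?_) (fun s _ t _ h => ?_)
        (fun y hy => ?_) (fun s _ => ?_)).symm
      · rw [mem_filter]
        exact ⟨mem_univ _, fun j hj => Function.update_of_ne hj _ _⟩
      · exact Function.update_injective x i h
      · exact ⟨y i, mem_univ _, ((h1 y).1 (mem_filter.1 hy).2).symm⟩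
      · simp
    rw [h2]
    simp_rw [updateProb_eq, div_mul_eq_mul_div]
    rw [← sum_div, sum_update (fun y => g.gibbs β y * f y), orbitAvg]
  simp only [mulVec, dotProduct, logitMatrix]
  simp_rw [mul_assoc, ← mul_sum, sum_mul]
  rw [sum_comm]
  simp_rw [hsite]

theorem sum_logitMatrix [Nonempty V] (g : OpinionGame G) (β : ℝ) (x : Profile V) :
    ∑ y, g.logitMatrix β x y = 1 := by
  have h := g.logitMatrix_mulVec β (fun _ => 1) x
  have h1 : ∀ i, orbitAvg (g.gibbs β) (flipAt i) (fun _ => 1) x = 1 := fun i => by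
    rw [orbitAvg, mul_one, mul_one,
      div_self (add_pos (g.gibbs_pos β x) (g.gibbs_pos β (flipAt i x))).ne']
  simpa [mulVec, dotProduct, h1] using h

/-- Detailed balance holds player by player: profiles agreeing off i share the same normaliser. -/
theorem logitMatrix_reversible (g : OpinionGame G) (β : ℝ) (x y : Profile V) :
    g.gibbs β x * g.logitMatrix β x y = g.gibbs β y * g.logitMatrix β y x := by
  simp only [logitMatrix, mul_left_comm (g.gibbs β _), mul_sum]
  refine sum_congr rfl fun i _ => congrArg _ ?_
  by_cases h : ∀ j, j ≠ i → y j = x j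
  · have hy : Function.update x i (y i) = y := by
      rw [eq_comm, Function.eq_update_iff]; exact ⟨rfl, h⟩
    have hx : Function.update y i (x i) = x := by
      rw [eq_comm, Function.eq_update_iff]; exact ⟨rfl, fun j hj => (h j hj).symm⟩
    rw [if_pos h, if_pos fun j hj => (h j hj).symm, updateProb_eq, updateProb_eq, hx, hy,
      ← sum_update, ← sum_update]
    have : ∀ z, Function.update y i z = Function.update x i z := fun z => by
      rw [← hy, Function.update_idem]
    simp_rw [this]
    ring
  · rw [if_neg h, if_neg fun h' => h fun j hj => (h' j hj).symm, mul_zero, mul_zero]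

theorem logitMatrix_contraction [Nonempty V] (g : OpinionGame G) (β : ℝ) (f : Profile V → ℝ) :
    ∑ x, g.gibbs β x * (g.logitMatrix β *ᵥ f) x ^ 2 ≤
      ∑ x, g.gibbs β x * (f x * (g.logitMatrix β *ᵥ f) x) :=
  contraction_of_mulVec_eq_orbitAvg (g.gibbs_pos β) flipAt_involutive f (g.logitMatrix_mulVec β f)

theorem logitMatrix_poincare [Nonempty V] (g : OpinionGame G) {β : ℝ} (hβ : 0 ≤ β)
    (f : Profile V → ℝ) (hf : ∑ x, g.gibbs β x * f x = 0) :
    ∑ x, g.gibbs β x * f x ^ 2 ≤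
      2 * (Fintype.card V : ℝ) ^ 2 * Real.exp (β * (2 * g.cutwidth)) *
        (∑ x, g.gibbs β x * f x ^ 2 - ∑ x, g.gibbs β x * (f x * (g.logitMatrix β *ᵥ f) x)) := by
  have hn : (Fintype.card V : ℝ) ≠ 0 := by exact_mod_cast Fintype.card_ne_zero
  obtain ⟨σ, hσ⟩ := g.exists_ordering_cutWeight_le_cutwidth
  rw [dirichlet_of_mulVec_eq_orbitAvg (g.gibbs_pos β) flipAt_involutive f
    (g.logitMatrix_mulVec β f)]
  -- The path bound has factor nK and the Dirichlet form has 1/(2n), hence 2n²K.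
  refine (poincare_of_ordering (g.gibbs_pos β) (g.sum_gibbs β) (Real.exp_pos _) σ
    (fun k hk => g.gibbs_mul_gibbs_le hβ _ (hσ k hk)) hf).trans_eq ?_
  field_simp

end OpinionGame

end

/-! ### The mixing time bound -/

theorem mainTheorem1 :
    ∃ (p : MvPolynomial (Fin 2) ℝ) (C : ℝ), 0 < C ∧
      ∀ (V : Type u) [Fintype V] [DecidableEq V] (G : SimpleGraph V), G.Connected →
        ∀ (g : OpinionGame G) (β : ℝ), 0 ≤ β →
          ∃ π : Profile V → ℝ,
            IsStationaryDist (g.logitMatrix β) π ∧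
            (∀ π' : Profile V → ℝ, IsStationaryDist (g.logitMatrix β) π' → π' = π) ∧
            (mixedTimes (g.logitMatrix β) π (1 / 4)).Nonempty ∧
            (mixingTime (g.logitMatrix β) π (1 / 4) : ℝ) ≤
              (1 + β) * MvPolynomial.eval ![(Fintype.card V : ℝ), g.wMax] p *
                Real.exp (β * (C * g.cutwidth)) := by
  -- The product is 2n² from ρ times a bound for (2 + c)/(1 + β); the final 1 pays for rounding up.
  -- C = 2 comes from the exchange inequality.
  refine ⟨2 * MvPolynomial.X 0 ^ 2 * (2 + 2 * MvPolynomial.X 0 +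
    MvPolynomial.X 0 ^ 2 * MvPolynomial.X 1) + 1, 2, two_pos, ?_⟩
  intro V _ _ G hG g β hβ
  have : Nonempty V := hG.nonempty
  have hn : (0 : ℝ) < Fintype.card V := by exact_mod_cast Fintype.card_pos
  set n := (Fintype.card V : ℝ)
  set K := Real.exp (β * (2 * g.cutwidth)) with hK
  have hK1 : 1 ≤ K := Real.one_le_exp (mul_nonneg hβ (mul_nonneg two_pos.le g.cutwidth_nonneg))
  have hρ : 0 < 2 * n ^ 2 * K := by positivity
  have hw := g.wMax_nonneg
  set c := n + β * (n + n ^ 2 * g.wMax) with hc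
  have hc0 : 0 ≤ c := by positivity
  have hpoin := g.logitMatrix_poincare hβ
  have hmem := mem_mixedTimes_of_poincare hρ (g.gibbs_pos β) (g.sum_gibbs β) (g.sum_logitMatrix β)
    (g.logitMatrix_reversible β) (g.logitMatrix_contraction β) hpoin (g.one_div_gibbs_le hβ)
    (Nat.le_ceil (2 * n ^ 2 * K * (2 + c)))
  refine ⟨g.gibbs β, isStationaryDist_of_reversible (g.gibbs_pos β) (g.sum_gibbs β)
    (g.sum_logitMatrix β) (g.logitMatrix_reversible β), fun π' h' =>
    eq_of_isStationaryDist_of_poincare (g.gibbs_pos β) (g.sum_gibbs β) (g.sum_logitMatrix β)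
      (g.logitMatrix_reversible β) hpoin h', ⟨_, hmem⟩, ?_⟩
  calc (mixingTime (g.logitMatrix β) (g.gibbs β) (1 / 4) : ℝ)
      ≤ (⌈2 * n ^ 2 * K * (2 + c)⌉₊ : ℝ) := by exact_mod_cast Nat.sInf_le hmem
    _ ≤ 2 * n ^ 2 * K * (2 + c) + 1 := (Nat.ceil_lt_add_one (by positivity)).le
    _ ≤ 2 * n ^ 2 * K * ((1 + β) * (2 + 2 * n + n ^ 2 * g.wMax)) + (1 + β) * K := by
        have h1 : 2 + c ≤ (1 + β) * (2 + 2 * n + n ^ 2 * g.wMax) := by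
          have : 0 ≤ n ^ 2 * g.wMax := by positivity
          have : 0 ≤ β * (2 + n) := by positivity
          rw [hc]
          linarith
        have h2 : 1 ≤ (1 + β) * K := one_le_mul_of_one_le_of_one_le (by linarith) hK1
        gcongr
    _ = _ := by
        simp only [map_add, map_mul, map_pow, MvPolynomial.eval_X, map_ofNat, map_one,
          Matrix.cons_val_zero, Matrix.cons_val_one]
        ring
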